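/- Let $n_o\ge 2$, $\hat k_b\ge 1$, $k_c$ and $k$ be integers. A \emph{generalized tree-like graph} with these parameters is a bipartite graph $G$ with parts $V_o=\{o_1,\dots,o_{n_o}\}$ (orchestration vertices) and $V_c=\{c_1,\dots,c_k\}$ (clients) such that every client is adjacent to at least one orchestration vertex, every $o_i$ has exactly $k_c$ neighbours, $|N_{o_i}\cap N_{o_{i+1}}|=\hat k_b$ for $1\le i<n_o$, and $N_{o_i}\cap N_{o_j}=\emptyset$ whenever $|i-j|\ge 2$ (so $n_o=\frac{k-\hat k_b}{k_c-\hat k_b}$ if $k_c>\hat k_b$). A client adjacent to exactly two orchestration vertices is called a bridge, and $\bar k_b$ denotes the maximum, over all $i$, of the number of bridges adjacent to $o_i$. A $\sigma_y$-measurement of the qubit at a vertex $a$ turns a graph $H$ into $\tau_a(H)-a$, where $\tau_a(H)$ is obtained from $H$ by complementing the subgraph induced by the neighbourhood of $a$. Let $G_{er}$ (the artificial enhanced ring topology) be the graph on the $k$ clients obtained from $G$ by performing this operation successively at $o_1,\dots,o_{n_o}$. For a graph $H=(V,E)$ with $n$ vertices let $|H\rangle=\prod_{\{a,b\}\in E}\mathtt{CZ}_{ab}|+\rangle^{\otimes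 n}$ be its graph state. The Schmidt measure of an $n$-qubit state $|\psi\rangle$ is $E_S(|\psi\rangle)=\log_2 r$, where $r$ is the least number of terms in an expansion $|\psi\rangle=\sum_{i=1}^{r}\xi_i\,|\psi_i^{(1)}\rangle\otimes\cdots\otimes|\psi_i^{(n)}\rangle$ with $\xi_i\in\mathbb C$ and $|\psi_i^{(j)}\rangle\in\mathbb C^2$. If $k_c>\bar k_b$ and $k_c>2$, then $$E_S(|G_{er}\rangle)=n_o .$$ -/

import Mathlib

noncomputable section

namespace QLAN

/-! ### Pure states of qubits, graph states, Schmidt measure -/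

/-- A (not necessarily normalized) pure state of a register of qubits indexed by `V`, given by its
amplitudes in the computational basis; basis states are the bit strings `V → Fin 2`. -/
abbrev QState (V : Type*) : Type _ := (V → Fin 2) → ℂ

/-- The product vector `⨂_v φ_v`. -/
def productState {V : Type*} [Fintype V] (φ : V → Fin 2 → ℂ) : QState V :=
  fun x => ∏ v, φ v (x v)

/-- `ψ` is a superposition of `r` product vectors. -/
def IsSumOfProducts {V : Type*} [Fintype V] (ψ : QState V) (r : ℕ) : Prop :=
  ∃ (ξ : Fin r → ℂ) (φ : Fin r → V → Fin 2 → ℂ), ψ = ∑ i, ξ i • productState (φ i)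

/-- The minimal number of terms in an expansion of `ψ` into product vectors. -/
def schmidtRank {V : Type*} [Fintype V] (ψ : QState V) : ℕ :=
  sInf {r : ℕ | IsSumOfProducts ψ r}

/-- Expansions exist (for instance in the computational basis), so the infimum above is a
minimum. -/
theorem isSumOfProducts_schmidtRank {V : Type*} [Fintype V] (ψ : QState V) :
    IsSumOfProducts ψ (schmidtRank ψ) := by
  classical
  refine Nat.sInf_mem (s := {r : ℕ | IsSumOfProducts ψ r}) ?_
  let e := (Fintype.equivFin (V → Fin 2)).symm
  refine ⟨Fintype.card (V → Fin 2), fun i => ψ (e i),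
    fun i v b => if b = e i v then 1 else 0, ?_⟩
  funext x
  simp only [Finset.sum_apply, Pi.smul_apply, productState, smul_eq_mul]
  rw [e.sum_comp (fun y => ψ y * ∏ v, if x v = y v then (1 : ℂ) else 0),
    Finset.sum_eq_single x]
  · simp
  · intro y _ hy
    obtain ⟨v, hv⟩ := Function.ne_iff.mp hy
    rw [Finset.prod_eq_zero (Finset.mem_univ v) (if_neg (Ne.symm hv)), mul_zero]
  · simp

/-- The Schmidt measure `E_S(|ψ⟩) = log₂ r`, with `r` the minimal number of product terms. -/
def schmidtMeasure {V : Type*} [Fintype V] (ψ : QState V) : ℝ :=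
  Real.logb 2 (schmidtRank ψ)

/-- The state `|+⟩ ⊗ ⋯ ⊗ |+⟩`. -/
def plusState (V : Type*) [Fintype V] : QState V :=
  productState fun _ _ => ((1 / Real.sqrt 2 : ℝ) : ℂ)

open Classical in
/-- The diagonal entries of the controlled-`Z` gate acting on the two qubits of `e`: the basis state
`x` gets the sign `-1` exactly if both qubits are in state `1`. -/
def czPhase {V : Type*} (e : Sym2 V) (x : V → Fin 2) : ℂ :=
  if ∀ v ∈ e, x v = 1 then -1 else 1

open Classical in
/-- The graph state `|G⟩ = ∏_{ab ∈ E} CZ_{ab} |+⟩^{⊗ n}`. The gates are diagonal in the computational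
basis, so applying all of them multiplies each amplitude by the product of the diagonal entries. -/
def graphState {V : Type*} [Fintype V] (G : SimpleGraph V) : QState V :=
  fun x => (∏ e ∈ G.edgeFinset, czPhase e x) * plusState V x

/-! ### Local complementation and `σ_y` measurements -/

/-- Local complementation of `G` at `a`: the subgraph induced by the neighborhood of `a` is replaced
by its complement. -/
def localComplement {V : Type*} (G : SimpleGraph V) (a : V) : SimpleGraph V where
  Adj u v := u ≠ v ∧ Xor (G.Adj u v) (G.Adj a u ∧ G.Adj a v)
  symm := ⟨fun u v h => ⟨h.1.symm, by rw [G.adj_comm v u, and_comm (a := G.Adj a v)]; exact h.2⟩⟩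
  loopless := ⟨fun _ h => h.1 rfl⟩

/-- Effect on the graph of a `σ_y` measurement of the qubit `a`: local complementation at `a`
followed by the deletion of `a`. All edges at `a` are removed; the vertex itself stays in the type as
an isolated vertex and is dropped in `enhancedRing`. -/
def yMeasure {V : Type*} (G : SimpleGraph V) (a : V) : SimpleGraph V :=
  (localComplement G a).deleteIncidenceSet a

/-- The artificial topology on the `k` clients obtained from a graph on `no` orchestration vertices
`Sum.inl i` and `k` client vertices `Sum.inr c`, by `σ_y` measurements of all orchestration qubits,
one after the other. -/
def enhancedRing {no k : ℕ} (G : SimpleGraph (Fin no ⊕ Fin k)) : SimpleGraph (Fin k) :=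
  ((List.finRange no).foldl (fun H i => yMeasure H (Sum.inl i)) G).comap Sum.inr

/-! ### Generalized tree-like graphs -/

open Classical in
/-- The clients adjacent to the orchestration vertex `i`. -/
def clientNbhd {no k : ℕ} (G : SimpleGraph (Fin no ⊕ Fin k)) (i : Fin no) : Finset (Fin k) :=
  Finset.univ.filter fun c => G.Adj (Sum.inl i) (Sum.inr c)

open Classical in
/-- The rank of a client: the number of orchestration vertices adjacent to it. A client of rank
`r > 1` is an `r`-rank bridge. -/
def clientRank {no k : ℕ} (G : SimpleGraph (Fin no ⊕ Fin k)) (c : Fin k) : ℕ :=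
  (Finset.univ.filter fun i : Fin no => G.Adj (Sum.inl i) (Sum.inr c)).card

/-- The bridge degree of an orchestration vertex: the number of its neighbors that are `2`-rank
bridges. -/
def bridgeDegree {no k : ℕ} (G : SimpleGraph (Fin no ⊕ Fin k)) (i : Fin no) : ℕ :=
  ((clientNbhd G i).filter fun c => clientRank G c = 2).card

/-- The maximal bridge degree over all orchestration vertices. -/
def maxBridgeDegree {no k : ℕ} (G : SimpleGraph (Fin no ⊕ Fin k)) : ℕ :=
  Finset.univ.sup (bridgeDegree G)

/-- Generalized tree-like graphs on `no ≥ 2` orchestration vertices and `k` clients: the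
concatenation in a line of `no` stars, centered at the orchestration vertices, with `kc` leaves each,
such that consecutive stars share exactly `kb ≥ 1` clients and other stars share none. Consequently
all bridges have rank two, the first and the last orchestration vertex have bridge degree `kb` (the
minimal one), all others have bridge degree `2 * kb`, and `k = no * kc - (no - 1) * kb`. -/
structure IsGeneralizedTreeLike {no k : ℕ} (G : SimpleGraph (Fin no ⊕ Fin k)) (kc kb : ℕ) :
    Prop where
  two_le : 2 ≤ no
  kb_pos : 1 ≤ kb
  /-- no edges between orchestration vertices -/
  not_adj_inl : ∀ i j : Fin no, ¬ G.Adj (Sum.inl i) (Sum.inl j)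
  /-- no edges between clients -/
  not_adj_inr : ∀ c d : Fin k, ¬ G.Adj (Sum.inr c) (Sum.inr d)
  /-- every client belongs to some star -/
  exists_adj : ∀ c : Fin k, ∃ i : Fin no, G.Adj (Sum.inl i) (Sum.inr c)
  card_clientNbhd : ∀ i : Fin no, (clientNbhd G i).card = kc
  card_inter : ∀ i j : Fin no, (i : ℕ) + 1 = j → (clientNbhd G i ∩ clientNbhd G j).card = kb
  disjoint : ∀ i j : Fin no, (i : ℕ) + 1 < j → Disjoint (clientNbhd G i) (clientNbhd G j)

end QLAN

end

namespace QLAN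

/-! ### Tensor rank of products of star phases -/

/-! Two clients are joined in the final graph exactly when an odd number of stars contain both.
Hence, up to a constant, the amplitude at `x` is the product over the stars of `(-1) ^ (w.choose
2)`, with `w` the number of ones of `x` in the star (`graphState_enhancedRing`).

Upper bound: each factor is a combination of `I ^ w` and `(-I) ^ w`, both product vectors, so
expanding gives `2 ^ no` terms (`isSumOfProducts_cliquePhase`).

Lower bound: across a cut of the clients, weights add and `(m + n).choose 2` has cross term `m * n`.
Up to signs of rows and columns, the amplitude matrix of the cut thus depends only on the star
parities on each side, as a Hadamard matrix. If both sides realize all parity patterns, its rank `2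
^ no` bounds the number of product terms from below (`le_of_isSumOfProducts_cliquePhase`). The
bridge and degree hypotheses serve to build such a cut (`exists_cut`). -/

theorem IsSumOfProducts.of_fintype {V ι : Type*} [Fintype V] [Fintype ι] {ψ : QState V}
    (ξ : ι → ℂ) (φ : ι → V → Fin 2 → ℂ) (h : ψ = ∑ i, ξ i • productState (φ i)) :
    IsSumOfProducts ψ (Fintype.card ι) := by
  let e := (Fintype.equivFin ι).symm
  exact ⟨ξ ∘ e, φ ∘ e, h.trans (e.sum_comp fun i => ξ i • productState (φ i)).symm⟩

/-- The sign sequence `1, 1, -1, -1, ...` satisfies `s (w + 2) = -s w`, whose characteristic roots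
are `I` and `-I`. -/
theorem neg_one_pow_choose_two (w : ℕ) :
    (-1 : ℂ) ^ w.choose 2 =
      (1 - Complex.I) / 2 * Complex.I ^ w + (1 + Complex.I) / 2 * (-Complex.I) ^ w := by
  induction w using Nat.twoStepInduction with
  | zero => simp; ring
  | one =>
    have h := Complex.I_mul_I
    rw [Nat.choose_eq_zero_of_lt one_lt_two, pow_zero, pow_one, pow_one]
    linear_combination h
  | more n ih _ =>
    have h : (n + 2).choose 2 = n.choose 2 + (2 * n + 1) := by
      rw [Nat.choose_succ_succ' (n + 1) 1, Nat.choose_succ_succ' n 1]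
      simp
      ring
    have h2 : (-1 : ℂ) ^ (2 * n + 1) = -1 := Odd.neg_one_pow ⟨n, rfl⟩
    rw [h, pow_add, h2, ih, pow_add, pow_add, neg_sq, Complex.I_sq]
    ring

/-- The phase that complete graphs on the vertex sets `S i` give to the basis state `x`. -/
def cliquePhase {V ι : Type*} [Fintype ι] (S : ι → Finset V) (x : V → Fin 2) : ℂ :=
  ∏ i, (-1 : ℂ) ^ ((S i).filter fun c => x c = 1).card.choose 2

theorem isSumOfProducts_cliquePhase {V ι : Type*} [Fintype V] [Fintype ι] (S : ι → Finset V)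
    (C : ℂ) : IsSumOfProducts (fun x => C * cliquePhase S x) (2 ^ Fintype.card ι) := by
  classical
  have hcard : Fintype.card (ι → Bool) = 2 ^ Fintype.card ι := by simp
  rw [← hcard]
  let a : Bool → ℂ := fun b => if b then (1 - Complex.I) / 2 else (1 + Complex.I) / 2
  let ω : Bool → ℂ := fun b => if b then Complex.I else -Complex.I
  refine IsSumOfProducts.of_fintype (fun s => C * ∏ i, a (s i))
    (fun s c b => ∏ i, if c ∈ S i ∧ b = 1 then ω (s i) else 1) ?_
  funext x
  have key : ∀ i, (-1 : ℂ) ^ ((S i).filter fun c => x c = 1).card.choose 2 =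
      ∑ b : Bool, a b * ∏ c, if c ∈ S i ∧ x c = 1 then ω b else 1 := by
    intro i
    have hp : ∀ z : ℂ, (∏ c, if c ∈ S i ∧ x c = 1 then z else 1) =
        z ^ ((S i).filter fun c => x c = 1).card := by
      intro z
      rw [Finset.prod_ite, Finset.prod_const, Finset.prod_const_one, mul_one]
      congr 2
      ext c
      simp
    rw [neg_one_pow_choose_two, Fintype.sum_bool, hp, hp]
    simp [a, ω]
  simp only [cliquePhase, key, Finset.prod_univ_sum, Fintype.piFinset_univ, Finset.mul_sum,
    Finset.sum_apply, Pi.smul_apply, productState, smul_eq_mul]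
  refine Finset.sum_congr rfl fun s _ => ?_
  rw [Finset.prod_mul_distrib, mul_assoc, Finset.prod_comm]

/-- The sign `(-1) ^ (a * b)` of two bits. -/
def bitSign (a b : ZMod 2) : ℂ := if a = 1 ∧ b = 1 then -1 else 1

theorem neg_one_pow_mul (m n : ℕ) : (-1 : ℂ) ^ (m * n) = bitSign m n := by
  simp only [bitSign, ZMod.natCast_eq_one_iff_odd, ← Nat.odd_mul]
  split_ifs with h
  · exact h.neg_one_pow
  · exact (Nat.not_odd_iff_even.1 h).neg_one_pow

theorem sum_bitSign_mul_bitSign (a b : ZMod 2) :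
    ∑ c, bitSign a c * bitSign c b = if a = b then 2 else 0 := by
  have hu : (Finset.univ : Finset (ZMod 2)) = {0, 1} := rfl
  have hz : ∀ a : ZMod 2, a = 0 ∨ a = 1 := by decide
  rw [hu, Finset.sum_pair zero_ne_one]
  rcases hz a with rfl | rfl <;> rcases hz b with rfl | rfl <;> norm_num [bitSign]

/-- The Sylvester–Hadamard matrix. -/
def hadamardMatrix (ι : Type*) [Fintype ι] : Matrix (ι → ZMod 2) (ι → ZMod 2) ℂ :=
  Matrix.of fun u v => ∏ i, bitSign (u i) (v i)

theorem hadamardMatrix_mul_self (ι : Type*) [Fintype ι] [DecidableEq ι] :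
    hadamardMatrix ι * hadamardMatrix ι = (2 ^ Fintype.card ι : ℂ) • 1 := by
  ext u v
  simp only [Matrix.mul_apply, hadamardMatrix, Matrix.of_apply, ← Finset.prod_mul_distrib]
  rw [← Fintype.prod_sum fun i c => bitSign (u i) c * bitSign c (v i)]
  simp only [sum_bitSign_mul_bitSign, Matrix.smul_apply, Matrix.one_apply, smul_eq_mul]
  by_cases h : u = v
  · simp [h]
  · obtain ⟨i, hi⟩ := Function.ne_iff.1 h
    rw [Finset.prod_eq_zero (Finset.mem_univ i) (if_neg hi), if_neg h, mul_zero]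

theorem rank_hadamardMatrix (ι : Type*) [Fintype ι] [DecidableEq ι] :
    (hadamardMatrix ι).rank = 2 ^ Fintype.card ι := by
  have h : IsUnit (hadamardMatrix ι) := by
    refine IsUnit.of_mul_eq_one (((2 ^ Fintype.card ι : ℂ)⁻¹) • hadamardMatrix ι) ?_
    rw [Matrix.mul_smul, hadamardMatrix_mul_self, smul_smul,
      inv_mul_cancel₀ (pow_ne_zero _ two_ne_zero), one_smul]
  rw [Matrix.rank_of_isUnit _ h]
  simp [ZMod.card]

theorem choose_two_add (m n : ℕ) :
    (m + n).choose 2 = m.choose 2 + n.choose 2 + m * n := by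
  induction n with
  | zero => simp
  | succ n ih =>
    rw [← add_assoc, Nat.choose_succ_succ' (m + n) 1, Nat.choose_succ_succ' n 1, ih]
    simp
    ring

/-- The parities of the restrictions of a bit string to the sets `S i`. -/
def parityMap {V ι : Type*} (S : ι → Finset V) : (V → ZMod 2) →ₗ[ZMod 2] (ι → ZMod 2) where
  toFun x i := ∑ c ∈ S i, x c
  map_add' x y := by ext i; simp [Finset.sum_add_distrib]
  map_smul' a x := by ext i; simp [Finset.mul_sum]

/-- Bit strings supported in `A`. -/
def supportedIn {V : Type*} (A : Set V) : Submodule (ZMod 2) (V → ZMod 2) where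
  carrier := {x | ∀ c ∉ A, x c = 0}
  add_mem' hx hy c hc := by simp [hx c hc, hy c hc]
  zero_mem' _ _ := rfl
  smul_mem' a x hx c hc := by simp [hx c hc]

/-- The computational basis state with the given bits. -/
def toBits {V : Type*} (z : V → ZMod 2) : V → Fin 2 := fun c => if z c = 1 then 1 else 0

theorem toBits_eq_one_iff {V : Type*} {z : V → ZMod 2} {c : V} : toBits z c = 1 ↔ z c = 1 := by
  simp [toBits]

theorem natCast_card_filter_eq_parityMap {V ι : Type*} (S : ι → Finset V) (x : V → ZMod 2)
    (i : ι) : (((S i).filter fun c => toBits x c = 1).card : ZMod 2) = parityMap S x i := by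
  simp only [Finset.natCast_card_filter, toBits_eq_one_iff]
  refine Finset.sum_congr rfl fun c _ => ?_
  generalize x c = b
  revert b
  decide

/-- If both sides of a cut see all parity patterns of the sets `S i`, the tensor rank is at least
`2 ^ |ι|`. -/
theorem le_of_isSumOfProducts_cliquePhase {V ι : Type*} [Fintype V] [Fintype ι]
    (S : ι → Finset V) {C : ℂ} (hC : C ≠ 0) (A : Set V)
    (hA : (supportedIn A).map (parityMap S) = ⊤)
    (hB : (supportedIn Aᶜ).map (parityMap S) = ⊤) {r : ℕ}
    (hr : IsSumOfProducts (fun x => C * cliquePhase S x) r) : 2 ^ Fintype.card ι ≤ r := by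
  classical
  have hA' : ∀ u, ∃ x ∈ supportedIn A, parityMap S x = u := fun u => by
    have : u ∈ (supportedIn A).map (parityMap S) := hA ▸ Submodule.mem_top
    simpa using this
  have hB' : ∀ u, ∃ x ∈ supportedIn Aᶜ, parityMap S x = u := fun u => by
    have : u ∈ (supportedIn Aᶜ).map (parityMap S) := hB ▸ Submodule.mem_top
    simpa using this
  -- For each parity pattern, one representative on either side of the cut: `2 ^ |ι|` rows and as
  -- many columns suffice.
  choose x hxA hx using hA'
  choose y hyB hy using hB'
  obtain ⟨ξ, φ, h⟩ := hr
  have hphase : ∀ u v, cliquePhase S (toBits (x u + y v)) =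
      cliquePhase S (toBits (x u)) * cliquePhase S (toBits (y v)) * hadamardMatrix ι u v := by
    intro u v
    simp only [cliquePhase, hadamardMatrix, Matrix.of_apply, ← Finset.prod_mul_distrib]
    refine Finset.prod_congr rfl fun i _ => ?_
    have hc : ((S i).filter fun c => toBits (x u + y v) c = 1).card =
        ((S i).filter fun c => toBits (x u) c = 1).card +
          ((S i).filter fun c => toBits (y v) c = 1).card := by
      rw [← Finset.card_union_of_disjoint]
      · congr 1
        ext c
        simp only [Finset.mem_filter, Finset.mem_union, toBits_eq_one_iff, Pi.add_apply,
          ← and_or_left]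
        by_cases hc : c ∈ A
        · simp [hyB v c (by simpa using hc)]
        · simp [hxA u c hc]
      · rw [Finset.disjoint_filter]
        intro c _ h1 h2
        rw [toBits_eq_one_iff] at h1 h2
        by_cases hc : c ∈ A
        · simp [hyB v c (by simpa using hc)] at h2
        · simp [hxA u c hc] at h1
    have e1 := natCast_card_filter_eq_parityMap S (x u) i
    have e2 := natCast_card_filter_eq_parityMap S (y v) i
    rw [hx] at e1
    rw [hy] at e2
    rw [← e1, ← e2, ← neg_one_pow_mul, ← pow_add, ← pow_add, ← choose_two_add, hc]
  have hsq : ∀ z : V → ZMod 2, cliquePhase S (toBits z) * cliquePhase S (toBits z) = 1 := by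
    intro z
    simp only [cliquePhase, ← Finset.prod_mul_distrib, ← mul_pow]
    simp
  -- Each product vector splits as a factor on `A` times a factor on `Aᶜ`. With the row and column
  -- signs and `C⁻¹` absorbed, the Hadamard matrix factors through dimension `r`.
  let P : Matrix (ι → ZMod 2) (Fin r) ℂ := Matrix.of fun u j =>
    cliquePhase S (toBits (x u)) * C⁻¹ * ξ j * ∏ c, if c ∈ A then φ j c (toBits (x u) c) else 1
  let Q : Matrix (Fin r) (ι → ZMod 2) ℂ := Matrix.of fun j v =>
    cliquePhase S (toBits (y v)) * ∏ c, if c ∈ A then 1 else φ j c (toBits (y v) c)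
  have hPQ : hadamardMatrix ι = P * Q := by
    ext u v
    have h1 := congrFun h (toBits (x u + y v))
    simp only [Finset.sum_apply, Pi.smul_apply, productState, smul_eq_mul] at h1
    have h2 : ∀ j, ∏ c, φ j c (toBits (x u + y v) c) =
        (∏ c, if c ∈ A then φ j c (toBits (x u) c) else 1) *
          ∏ c, if c ∈ A then 1 else φ j c (toBits (y v) c) := by
      intro j
      rw [← Finset.prod_mul_distrib]
      refine Finset.prod_congr rfl fun c _ => ?_
      by_cases hc : c ∈ A
      · simp [toBits, hc, hyB v c (by simpa using hc)]
      · simp [toBits, hc, hxA u c hc]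
    have h3 : hadamardMatrix ι u v =
        cliquePhase S (toBits (x u)) * cliquePhase S (toBits (y v)) * C⁻¹ *
        (C * cliquePhase S (toBits (x u + y v))) := by
      rw [hphase]
      have e1 := hsq (x u)
      have e2 := hsq (y v)
      field_simp
      linear_combination (-hadamardMatrix ι u v) * e1
        - hadamardMatrix ι u v * cliquePhase S (toBits (x u)) * cliquePhase S (toBits (x u)) * e2
    rw [h3]
    refine (congrArg _ h1).trans ?_
    rw [Matrix.mul_apply, Finset.mul_sum]
    refine Finset.sum_congr rfl fun j _ => ?_
    rw [h2]
    simp only [P, Q, Matrix.of_apply]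
    ring
  rw [← rank_hadamardMatrix, hPQ]
  exact (Matrix.rank_mul_le_left P Q).trans (by simpa using Matrix.rank_le_card_width P)

theorem schmidtMeasure_cliquePhase {V ι : Type*} [Fintype V] [Fintype ι]
    (S : ι → Finset V) {C : ℂ} (hC : C ≠ 0) (A : Set V)
    (hA : (supportedIn A).map (parityMap S) = ⊤)
    (hB : (supportedIn Aᶜ).map (parityMap S) = ⊤) :
    schmidtMeasure (fun x => C * cliquePhase S x) = Fintype.card ι := by
  have h : schmidtRank (fun x => C * cliquePhase S x) = 2 ^ Fintype.card ι :=
    le_antisymm (Nat.sInf_le (isSumOfProducts_cliquePhase S C))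
      (le_of_isSumOfProducts_cliquePhase S hC A hA hB (isSumOfProducts_schmidtRank _))
  rw [schmidtMeasure, h]
  push_cast
  rw [Real.logb_pow, Real.logb_self_eq_one one_lt_two, mul_one]


/-! ### The graph state of the enhanced ring -/

open Classical in
/-- After `σ_y` measurements of an independent set of orchestration vertices, the adjacency of two
clients is flipped once for every measured vertex adjacent to both. -/
theorem sign_adj_foldl_yMeasure {α β : Type*} (l : List α) (hl : l.Nodup)
    (H : SimpleGraph (α ⊕ β)) (hH : ∀ i j, ¬ H.Adj (Sum.inl i) (Sum.inl j)) {c d : β}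
    (hcd : c ≠ d) :
    (if (l.foldl (fun H i => yMeasure H (Sum.inl i)) H).Adj (Sum.inr c) (Sum.inr d)
      then (-1 : ℂ) else 1) =
    (if H.Adj (Sum.inr c) (Sum.inr d) then -1 else 1) *
      (l.map fun i => if H.Adj (Sum.inl i) (Sum.inr c) ∧ H.Adj (Sum.inl i) (Sum.inr d)
        then (-1 : ℂ) else 1).prod := by
  induction l generalizing H with
  | nil => rw [List.foldl_nil, List.map_nil, List.prod_nil, mul_one]
  | cons a l ih =>
    rw [List.nodup_cons] at hl
    have h1 : ∀ i j, ¬ (yMeasure H (Sum.inl a)).Adj (Sum.inl i) (Sum.inl j) := by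
      intro i j
      simp [yMeasure, SimpleGraph.deleteIncidenceSet_adj, localComplement, hH, Xor]
    -- Complementing at `a` flips only pairs of neighbours of `a`, and no orchestration vertex is
    -- one; the deletion spares `i` because `i ≠ a`.
    have h2 : ∀ i ∈ l, ∀ e, (yMeasure H (Sum.inl a)).Adj (Sum.inl i) (Sum.inr e) ↔
        H.Adj (Sum.inl i) (Sum.inr e) := by
      intro i hi e
      have : i ≠ a := fun h => hl.1 (h ▸ hi)
      simp [yMeasure, SimpleGraph.deleteIncidenceSet_adj, localComplement, hH, Xor, this]
    have h3 : (yMeasure H (Sum.inl a)).Adj (Sum.inr c) (Sum.inr d) ↔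
        Xor (H.Adj (Sum.inr c) (Sum.inr d))
          (H.Adj (Sum.inl a) (Sum.inr c) ∧ H.Adj (Sum.inl a) (Sum.inr d)) := by
      simp [yMeasure, SimpleGraph.deleteIncidenceSet_adj, localComplement, hcd]
    rw [List.foldl_cons, ih hl.2 _ h1, List.map_cons, List.prod_cons, ← mul_assoc]
    congr 1
    · by_cases p : H.Adj (Sum.inr c) (Sum.inr d) <;>
        by_cases q : H.Adj (Sum.inl a) (Sum.inr c) ∧ H.Adj (Sum.inl a) (Sum.inr d) <;>
        simp [h3, p, q, Xor]
    · congr 1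
      refine List.map_congr_left fun i hi => ?_
      rw [h2 i hi, h2 i hi]

open Classical in
theorem sign_adj_enhancedRing {no k : ℕ} (G : SimpleGraph (Fin no ⊕ Fin k))
    (ho : ∀ i j : Fin no, ¬ G.Adj (Sum.inl i) (Sum.inl j))
    (hc : ∀ c d : Fin k, ¬ G.Adj (Sum.inr c) (Sum.inr d)) {c d : Fin k} (hcd : c ≠ d) :
    (if (enhancedRing G).Adj c d then (-1 : ℂ) else 1) =
      ∏ i, if c ∈ clientNbhd G i ∧ d ∈ clientNbhd G i then (-1 : ℂ) else 1 := by
  have h := sign_adj_foldl_yMeasure (List.finRange no) (List.nodup_finRange no) G ho hcd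
  rw [if_neg (hc c d), one_mul, ← Fin.prod_univ_def] at h
  simpa [enhancedRing, clientNbhd] using h

theorem mem_image_offDiag {V : Type*} [DecidableEq V] (s : Finset V) (e : Sym2 V) :
    e ∈ s.offDiag.image Sym2.mk.uncurry ↔ ¬ e.IsDiag ∧ ∀ v ∈ e, v ∈ s := by
  induction e with | _ c d => ?_
  simp only [Finset.mem_image, Finset.mem_offDiag, Prod.exists, Sym2.mk_isDiag_iff, Sym2.mem_iff,
    forall_eq_or_imp, forall_eq, Function.uncurry_apply_pair, Sym2.eq_iff]
  constructor
  · rintro ⟨a, b, ⟨ha, hb, hab⟩, ⟨rfl, rfl⟩ | ⟨rfl, rfl⟩⟩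
    · exact ⟨hab, ha, hb⟩
    · exact ⟨hab.symm, hb, ha⟩
  · rintro ⟨h, h1, h2⟩
    exact ⟨c, d, ⟨h1, h2, h⟩, Or.inl ⟨rfl, rfl⟩⟩

/-- Only pairs of clients that are both in state 1 contribute. Exchanging the product over such
pairs with the one over stars, a star containing `w` ones receives `w.choose 2` signs. -/
theorem prod_czPhase_enhancedRing {no k : ℕ} (G : SimpleGraph (Fin no ⊕ Fin k))
    (ho : ∀ i j : Fin no, ¬ G.Adj (Sum.inl i) (Sum.inl j))
    (hc : ∀ c d : Fin k, ¬ G.Adj (Sum.inr c) (Sum.inr d))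
    [Fintype (enhancedRing G).edgeSet] (x : Fin k → Fin 2) :
    ∏ e ∈ (enhancedRing G).edgeFinset, czPhase e x = cliquePhase (clientNbhd G) x := by
  classical
  let T : Finset (Sym2 (Fin k)) :=
    (Finset.univ.filter fun c => x c = 1).offDiag.image Sym2.mk.uncurry
  have hT : ∀ e, e ∈ T ↔ ¬ e.IsDiag ∧ ∀ v ∈ e, x v = 1 := by
    intro e
    simp only [T, mem_image_offDiag, Finset.mem_filter, Finset.mem_univ, true_and]
  have h1 : ∏ e ∈ (enhancedRing G).edgeFinset, czPhase e x =
      ∏ e ∈ T, if e ∈ (enhancedRing G).edgeSet then (-1 : ℂ) else 1 := by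
    rw [← Finset.prod_filter]
    have hsub : T.filter (· ∈ (enhancedRing G).edgeSet) ⊆ (enhancedRing G).edgeFinset :=
      fun e he => SimpleGraph.mem_edgeFinset.2 (Finset.mem_filter.1 he).2
    refine (Finset.prod_subset hsub fun e he hne => if_neg fun h => hne ?_).symm.trans
      (Finset.prod_congr rfl fun e he => if_pos ((hT e).1 (Finset.mem_filter.1 he).1).2)
    rw [SimpleGraph.mem_edgeFinset] at he
    exact Finset.mem_filter.2
      ⟨(hT e).2 ⟨(enhancedRing G).not_isDiag_of_mem_edgeSet he, h⟩, he⟩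
  have h2 : ∀ e ∈ T, (if e ∈ (enhancedRing G).edgeSet then (-1 : ℂ) else 1) =
      ∏ i, if ∀ v ∈ e, v ∈ clientNbhd G i then (-1 : ℂ) else 1 := by
    intro e he
    have hd := ((hT e).1 he).1
    clear he
    induction e with | _ c d => ?_
    have := sign_adj_enhancedRing G ho hc (c := c) (d := d) (by simpa using hd)
    simpa using this
  rw [h1, Finset.prod_congr rfl h2, Finset.prod_comm]
  refine Finset.prod_congr rfl fun i _ => ?_
  rw [Finset.prod_ite, Finset.prod_const_one, mul_one, Finset.prod_const,
    ← Sym2.card_image_offDiag]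
  congr 2
  ext e
  rw [Finset.mem_filter, hT, mem_image_offDiag, and_assoc]
  simp only [Finset.mem_filter]
  exact and_congr_right fun _ =>
    ⟨fun h v hv => ⟨h.2 v hv, h.1 v hv⟩, fun h => ⟨fun v hv => (h v hv).2, fun v hv => (h v hv).1⟩⟩

theorem graphState_enhancedRing {no k : ℕ} (G : SimpleGraph (Fin no ⊕ Fin k))
    (ho : ∀ i j : Fin no, ¬ G.Adj (Sum.inl i) (Sum.inl j))
    (hc : ∀ c d : Fin k, ¬ G.Adj (Sum.inr c) (Sum.inr d)) :
    graphState (enhancedRing G) =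
      fun x => ((1 / Real.sqrt 2 : ℝ) : ℂ) ^ k * cliquePhase (clientNbhd G) x := by
  classical
  funext x
  unfold graphState
  rw [prod_czPhase_enhancedRing G ho hc, mul_comm]
  simp [plusState, productState]

/-! ### A cut of maximal rank -/

theorem parityMap_single {V ι : Type*} [DecidableEq V] (S : ι → Finset V) (c : V) (i : ι) :
    parityMap S (Pi.single c 1) i = if c ∈ S i then 1 else 0 := by
  simp [parityMap, Finset.sum_pi_single']

theorem parityMap_single_mem {V ι : Type*} [DecidableEq V] (S : ι → Finset V) {A : Set V} {c : V}
    (hc : c ∈ A) :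
    parityMap S (Pi.single c 1) ∈ (supportedIn A).map (parityMap S) := by
  refine Submodule.mem_map_of_mem fun d hd => ?_
  exact Pi.single_eq_of_ne (fun h : d = c => hd (h ▸ hc)) _

theorem eq_top_of_single_mem {ι : Type*} [Fintype ι] [DecidableEq ι]
    (W : Submodule (ZMod 2) (ι → ZMod 2)) (h : ∀ i, Pi.single i 1 ∈ W) : W = ⊤ := by
  rw [eq_top_iff, ← (Pi.basisFun (ZMod 2) ι).span_eq, Submodule.span_le]
  rintro _ ⟨i, rfl⟩
  simpa using h i

namespace IsGeneralizedTreeLike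

variable {no k kc kb : ℕ} {G : SimpleGraph (Fin no ⊕ Fin k)}

theorem le_succ_of_mem (hG : IsGeneralizedTreeLike G kc kb) {i j : Fin no} {c : Fin k}
    (hi : c ∈ clientNbhd G i) (hj : c ∈ clientNbhd G j) : (j : ℕ) ≤ i + 1 := by
  by_contra h
  exact Finset.disjoint_left.1 (hG.disjoint i j (by omega)) hi hj

/-- Since the bridge degree is below `kc`, some neighbour is not a 2-rank bridge. It lies in no
second star: stars sharing a client have indices at most one apart, so a client in two stars has
rank exactly two. -/
theorem exists_mem_only (hG : IsGeneralizedTreeLike G kc kb) (hbridge : maxBridgeDegree G < kc)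
    (i : Fin no) : ∃ c ∈ clientNbhd G i, ∀ j, c ∈ clientNbhd G j → j = i := by
  classical
  have h1 : bridgeDegree G i < (clientNbhd G i).card := by
    rw [hG.card_clientNbhd]
    exact (Finset.le_sup (f := bridgeDegree G) (Finset.mem_univ i)).trans_lt hbridge
  obtain ⟨c, hc, hc'⟩ : ∃ c ∈ clientNbhd G i, clientRank G c ≠ 2 := by
    by_contra! h
    rw [bridgeDegree, Finset.filter_true_of_mem h] at h1
    exact lt_irrefl _ h1
  refine ⟨c, hc, fun j hj => ?_⟩
  by_contra hij
  apply hc'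
  have : (Finset.univ.filter fun l : Fin no => G.Adj (Sum.inl l) (Sum.inr c)) = {i, j} := by
    ext l
    have hl : l ∈ (Finset.univ.filter fun l : Fin no => G.Adj (Sum.inl l) (Sum.inr c)) ↔
        c ∈ clientNbhd G l := by simp [clientNbhd]
    rw [hl, Finset.mem_insert, Finset.mem_singleton]
    constructor
    · intro h
      have := hG.le_succ_of_mem hc hj
      have := hG.le_succ_of_mem hj hc
      have := hG.le_succ_of_mem hc h
      have := hG.le_succ_of_mem h hc
      have := hG.le_succ_of_mem h hj
      have := hG.le_succ_of_mem hj h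
      simp only [Fin.ext_iff] at hij ⊢
      omega
    · rintro (rfl | rfl) <;> assumption
  rw [clientRank, this, Finset.card_pair (Ne.symm hij)]

theorem exists_cut (hG : IsGeneralizedTreeLike G kc kb) (hbridge : maxBridgeDegree G < kc)
    (hkc : 2 < kc) : ∃ A : Set (Fin k),
      (supportedIn A).map (parityMap (clientNbhd G)) = ⊤ ∧
      (supportedIn Aᶜ).map (parityMap (clientNbhd G)) = ⊤ := by
  classical
  have hno := hG.two_le
  have hbr : ∀ i j : Fin no, (i : ℕ) + 1 = j →
      ∃ c, c ∈ clientNbhd G i ∧ c ∈ clientNbhd G j := by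
    intro i j hij
    have h : 0 < (clientNbhd G i ∩ clientNbhd G j).card := by
      rw [hG.card_inter i j hij]
      exact hG.kb_pos
    obtain ⟨c, hc⟩ := Finset.card_pos.1 h
    exact ⟨c, Finset.mem_inter.1 hc⟩
  choose p hp hp' using hG.exists_mem_only hbridge
  choose r hr hr' using hbr
  let o : Fin no := ⟨0, by omega⟩
  let o' : Fin no := ⟨1, by omega⟩
  -- A private client of the first star and one bridge per consecutive pair: their parity vectors
  -- `e₀` and `eᵢ + eᵢ₊₁` form a basis. The other side keeps the private clients of all other stars
  -- and needs only one more client of the first star.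
  let B : Set (Fin k) := {c | c = p o ∨ ∃ i j h, c = r i j h}
  have hpr : ∀ l i j h, p l ≠ r i j h := by
    intro l i j h e
    have h1 := hp' l i (e ▸ hr i j h)
    have h2 := hp' l j (e ▸ hr' i j h)
    subst h1 h2
    omega
  have hpar : ∀ c i, parityMap (clientNbhd G) (Pi.single c 1) i =
      if c ∈ clientNbhd G i then 1 else 0 := parityMap_single _
  have hparp : ∀ i, parityMap (clientNbhd G) (Pi.single (p i) 1) = Pi.single i 1 := by
    intro i
    ext j
    rw [hpar, Pi.single_apply]
    exact if_congr ⟨hp' i j, fun h => h ▸ hp i⟩ rfl rfl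
  -- This is where `2 < kc` enters: the first star has a third client, besides its private client
  -- and its bridge already placed in `B`.
  obtain ⟨q, hq, hq'⟩ : ∃ q ∈ clientNbhd G o, q ∉ ({p o, r o o' rfl} : Finset (Fin k)) := by
    by_contra! h
    have h1 := (Finset.card_le_card h).trans Finset.card_le_two
    rw [hG.card_clientNbhd] at h1
    omega
  simp only [Finset.mem_insert, Finset.mem_singleton, not_or] at hq'
  have hqB : q ∉ B := by
    rintro (h | ⟨i, j, h, e⟩)
    · exact hq'.1 h
    -- A chosen bridge lying in the first star can only be the one joining the first two stars.
    · have h1 := hG.le_succ_of_mem hq (e ▸ hr' i j h)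
      have h2 : i = o := by
        ext
        simp only [o] at h1 ⊢
        omega
      have h3 : j = o' := by
        ext
        simp only [h2, o, o'] at h ⊢
        omega
      subst h2 h3
      exact hq'.2 e
  have hpB : ∀ i, i ≠ o → p i ∉ B := by
    rintro i hi (h | ⟨i', j, h, e⟩)
    · exact hi.symm (hp' i o (h ▸ hp o))
    · exact hpr _ _ _ _ e
  refine ⟨Bᶜ, eq_top_of_single_mem _ ?_, eq_top_of_single_mem _ ?_⟩
  · have hne : ∀ i, i ≠ o →
        Pi.single i 1 ∈ (supportedIn Bᶜ).map (parityMap (clientNbhd G)) := fun i hi =>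
      hparp i ▸ parityMap_single_mem _ (hpB i hi)
    intro i
    by_cases hi : i = o
    swap
    · exact hne i hi
    subst hi
    have hqm := parityMap_single_mem (clientNbhd G) (A := Bᶜ) hqB
    have ho' : o' ≠ o := by simp [o, o', Fin.ext_iff]
    -- The client `q` may itself be a second bridge to the next star; its parity vector is then `e₀
    -- + e₁`, and `e₁` is already available on this side.
    have e : Pi.single o 1 = parityMap (clientNbhd G) (Pi.single q 1) -
        (if q ∈ clientNbhd G o' then (1 : ZMod 2) else 0) • Pi.single o' 1 := by
      ext j
      rw [Pi.sub_apply, hpar, Pi.smul_apply, Pi.single_apply, Pi.single_apply]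
      by_cases h0 : j = o
      · subst h0
        simp [hq, ho'.symm]
      by_cases h1 : j = o'
      · subst h1
        simp [ho']
      · have : q ∉ clientNbhd G j := by
          intro h
          have h2 := hG.le_succ_of_mem hq h
          simp only [Fin.ext_iff, o, o'] at h0 h1 h2
          omega
        simp [h0, h1, this]
    rw [e]
    exact Submodule.sub_mem _ hqm (Submodule.smul_mem _ _ (hne o' ho'))
  · rw [compl_compl]
    have key : ∀ n (hn : n < no),
        Pi.single ⟨n, hn⟩ 1 ∈ (supportedIn B).map (parityMap (clientNbhd G)) := by
      intro n
      induction n with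
      | zero => exact fun _ => hparp o ▸ parityMap_single_mem _ (Or.inl rfl)
      | succ n ih =>
        intro hn
        let i : Fin no := ⟨n, by omega⟩
        let j : Fin no := ⟨n + 1, hn⟩
        have hrm := parityMap_single_mem (clientNbhd G) (A := B) (c := r i j rfl)
          (Or.inr ⟨i, j, rfl, rfl⟩)
        have hij : i ≠ j := by simp [i, j, Fin.ext_iff]
        -- The bridge has parity vector `eᵢ + eⱼ`, so the unit vectors are obtained one after the
        -- other along the line, starting from `e₀`.
        have e : Pi.single j 1 = parityMap (clientNbhd G) (Pi.single (r i j rfl) 1) -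
            Pi.single i (1 : ZMod 2) := by
          ext l
          rw [Pi.sub_apply, hpar, Pi.single_apply, Pi.single_apply]
          by_cases h0 : l = i
          · subst h0
            simp [hr i j rfl, hij]
          by_cases h1 : l = j
          · subst h1
            simp [hr' i j rfl, hij.symm]
          · have : r i j rfl ∉ clientNbhd G l := by
              intro h
              have h2 := hG.le_succ_of_mem (hr i j rfl) h
              have h3 := hG.le_succ_of_mem h (hr' i j rfl)
              simp only [Fin.ext_iff, i, j] at h0 h1 h2 h3
              omega
            simp [h0, h1, this]
        exact e ▸ Submodule.sub_mem _ hrm (ih _)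
    exact fun i => key i i.2

end IsGeneralizedTreeLike

end QLAN

theorem lemma7 {no k kc kb : ℕ} (G : SimpleGraph (Fin no ⊕ Fin k))
    (hG : QLAN.IsGeneralizedTreeLike G kc kb)
    (hbridge : QLAN.maxBridgeDegree G < kc) (hkc : 2 < kc) :
    QLAN.schmidtMeasure (QLAN.graphState (QLAN.enhancedRing G)) = no := by
  obtain ⟨A, hA, hB⟩ := hG.exists_cut hbridge hkc
  have hC : ((1 / Real.sqrt 2 : ℝ) : ℂ) ^ k ≠ 0 :=
    pow_ne_zero _ (Complex.ofReal_ne_zero.2 (by positivity))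
  rw [QLAN.graphState_enhancedRing G hG.not_adj_inl hG.not_adj_inr,
    QLAN.schmidtMeasure_cliquePhase _ hC A hA hB, Fintype.card_fin]
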